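/- Let $(X,d,m)$ be a metric measure space: $(X,d)$ is complete and separable and $m$ is a nonnegative Borel measure that is finite on bounded sets. Balls $B(x,r)$ are open. For $u:X\to\mathbb R$ let $\operatorname{lip}u(x)=\limsup_{y\to x}\frac{|u(y)-u(x)|}{d(x,y)}$ if $x$ is an accumulation point of $X$ and $\operatorname{lip}u(x)=0$ otherwise. Assume that $(X,d,m)$ is a PI space, that is, $m$ is doubling (there is $C_m>0$ with $0<m(B(x,2r))\le C_m\,m(B(x,r))<\infty$ for all $x\in X$, $r>0$) and a $(1,1)$-Poincaré inequality holds: there are $C_P>0$ and $\lambda\ge 1$ such that for every locally Lipschitz $u:X\to\mathbb R$, every $x\in X$ and $r>0$, $$\frac{1}{m(B(x,r))}\int_{B(x,r)}|u-u_{B(x,r)}|\,dm\le \frac{C_P\,r}{m(B(x,\lambda r))}\int_{B(x,\lambda r)}\operatorname{lip}u\,dm ,$$ where $u_{B(x,r)}$ is the mean value of $u$ on $B(x,r)$. For a Borel set $B\subset X$ and $u\in L^1_{\rm loc}(m|_B)$ put, for $A\subset X$ open, $$|Du|_B(A)=\inf\Big\{\liminf_{n\to\infty}\int_{A}\operatorname{lip}u_n\,d(m|_B):\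 u_n\in \mathrm{Lip}_{\rm loc}(A),\ u_n\to u \text{ in } L^1_{\rm loc}(A,m|_B)\Big\},$$ and $|Du|_B(F)=\inf\{|Du|_B(A): A\supset F \text{ open}\}$ for Borel sets $F$. Let $BV(B)$ be the space of $u\in L^1(m|_B)$ with $|Du|_B(B)<\infty$, with norm $\|u\|_{BV(B)}=\|u\|_{L^1(m|_B)}+|Du|_B(B)$. A Borel set $E\subset X$ is a $BV$-extension set if there are $C\ge1$ and a (not necessarily linear) map $T:BV(E)\to BV(X)$ such that $Tu=u$ $m$-a.e. on $E$ and $\|Tu\|_{BV(X)}\le C\|u\|_{BV(E)}$ for all $u\in BV(E)$. Finally, let $E^0=\big\{x\in X:\limsup_{r\to0}\frac{m(B(x,r)\cap E)}{m(B(x,r))}=0\big\}$. **Proposition.** Let $(X,d,m)$ be a PI space and let $E\subset X$ be a bounded $BV$-extension set with $m(E)>0$. Then there is a constant $C>0$ such that for all $x\in\overline{X\setminus E^0}$ and all $0<r<\operatorname{diam}(E)$, $$m(B(x,r)\cap E)\ge C\,m(B(x,r)).$$ -/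

import Mathlib

open MeasureTheory Filter Topology Metric
open scoped NNReal ENNReal

namespace MetricBV

section Defs

variable {X : Type*} [MetricSpace X]

/-- The local Lipschitz constant `lip u (x) = limsup_{y → x, y ≠ x} |u y - u x| / d (y, x)`.
At an isolated point the punctured neighbourhood filter is `⊥` and the value is `0`. -/
noncomputable def lip (u : X → ℝ) (x : X) : ℝ≥0∞ :=
  limsup (fun y => edist (u y) (u x) / edist y x) (𝓝[≠] x)

variable [MeasurableSpace X]

/-- `v n → u` in `L¹_loc` of the open set `A` with respect to `ν`: every point of `A` has a
neighbourhood on which the convergence holds in `L¹(ν)`. -/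
def TendstoL1Loc (ν : Measure X) (A : Set X) (v : ℕ → X → ℝ) (u : X → ℝ) : Prop :=
  ∀ x ∈ A, ∃ U ∈ 𝓝 x,
    Tendsto (fun n => ∫⁻ y in U ∩ A, ‖v n y - u y‖ₑ ∂ν) atTop (𝓝 0)

/-- The total variation `|Du|(A)` of `u` in the metric measure space `(X, d, ν)`, `A` open:
relaxation of `v ↦ ∫_A lip v dν` over functions that are locally Lipschitz on `A`. -/
noncomputable def totalVariationOpen (ν : Measure X) (u : X → ℝ) (A : Set X) : ℝ≥0∞ :=
  ⨅ (v : ℕ → X → ℝ) (_ : ∀ n, LocallyLipschitzOn A (v n)) (_ : TendstoL1Loc ν A v u),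
    liminf (fun n => ∫⁻ x in A, lip (v n) x ∂ν) atTop

/-- The total variation `|Du|(B)` of `u` in `(X, d, ν)`, for a Borel set `B`. -/
noncomputable def totalVariation (ν : Measure X) (u : X → ℝ) (B : Set X) : ℝ≥0∞ :=
  ⨅ (A : Set X) (_ : IsOpen A) (_ : B ⊆ A), totalVariationOpen ν u A

/-- The norm `‖u‖_{BV(B)} = ‖u‖_{L¹(μ|_B)} + |Du|_B (B)`, where `|Du|_B` is the total variation
computed in `(X, d, μ|_B)`; it is `∞` when `u` is not in `BV(B)`. -/
noncomputable def bvNorm (μ : Measure X) (B : Set X) (u : X → ℝ) : ℝ≥0∞ :=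
  (∫⁻ x in B, ‖u x‖ₑ ∂μ) + totalVariation (μ.restrict B) u B

/-- The space `BV(B)`, as a set of classes of functions modulo `μ|_B`-a.e. equality. -/
def BV (μ : Measure X) (B : Set X) : Set (X →ₘ[μ.restrict B] ℝ) :=
  {u | Integrable u (μ.restrict B) ∧ totalVariation (μ.restrict B) u B < ∞}

/-- `E` is a `BV`-extension set: there is a (not necessarily linear) bounded extension operator
`T : BV(E) → BV(X)`. -/
def IsBVExtensionSet (μ : Measure X) (E : Set X) : Prop :=
  MeasurableSet E ∧
    ∃ (C : ℝ≥0) (T : BV μ E → BV μ (Set.univ : Set X)), 1 ≤ C ∧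
      ∀ u : BV μ E,
        (∀ᵐ x ∂(μ.restrict E), (T u).1 x = u.1 x) ∧
        bvNorm μ Set.univ (T u).1 ≤ C * bvNorm μ E u.1

/-- The measure is doubling: `0 < μ(B(x,2r)) ≤ C μ(B(x,r)) < ∞` for all `x` and `r > 0`. -/
def IsDoubling (μ : Measure X) : Prop :=
  ∃ C : ℝ≥0, 0 < C ∧ ∀ (x : X) (r : ℝ), 0 < r →
    0 < μ (ball x (2 * r)) ∧
    μ (ball x (2 * r)) ≤ C * μ (ball x r) ∧
    C * μ (ball x r) < ∞

/-- The (weak) `(1,1)`-Poincaré inequality for locally Lipschitz functions. -/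
def SupportsPoincare (μ : Measure X) : Prop :=
  ∃ C Λ : ℝ, 0 < C ∧ 1 ≤ Λ ∧
    ∀ u : X → ℝ, LocallyLipschitz u → ∀ (x : X) (r : ℝ), 0 < r →
      (⨍⁻ y in ball x r, ‖u y - ⨍ z in ball x r, u z ∂μ‖ₑ ∂μ) ≤
        ENNReal.ofReal (C * r) * ⨍⁻ y in ball x (Λ * r), lip u y ∂μ

/-- `(X, d, μ)` is a PI space. (Completeness and separability of `X` are imposed by type classes
in the theorem; finiteness of `μ` on bounded sets is contained in the doubling condition.) -/
structure IsPISpace (μ : Measure X) : Prop where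
  doubling : IsDoubling μ
  poincare : SupportsPoincare μ

/-- The set `E⁰` of points where `E` has `μ`-density `0`. -/
def densityZero (μ : Measure X) (E : Set X) : Set X :=
  {x | limsup (fun r : ℝ => μ (ball x r ∩ E) / μ (ball x r)) (𝓝[>] 0) = 0}

end Defs

end MetricBV

/-!
The lower density bound is obtained by propagating it from the scale of `diam E` down to all smaller
scales, with one constant `η` throughout.

At the scale `2 * diam E` the ball `B (x, R)` contains all of `E`, which gives a first `η`. Suppose
that `E` has density at least `η` in `B (x, R)` but less than `η` in `B (x, R / N)`. A space with a
Poincaré inequality is connected, so the measure satisfies reverse doubling; for `N` large this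
leaves at least half of the measure of `E ∩ B (x, R)` outside `B (x, R / N)`. Take radii
`ρ i ↓ R / (4 N)` below `R / N` and cut-off functions equal to `1` on `B (x, ρ (i + 1))` and to `0`
off `B (x, ρ i)`. Their `BV (E)` norms are at most a multiple of `2 ^ i * μ (E ∩ B (x, ρ i)) / R`,
hence so is the total variation of their extensions. Such an extension is `1` on
`E ∩ B (x, ρ (i + 1))` and `0` on the large set `(E ∩ B (x, R)) \ B (x, R / N)`, so an isoperimetric
inequality with a superlinear gain bounds `μ (E ∩ B (x, ρ (i + 1)))`, and De Giorgi iteration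
forces `μ (E ∩ B (x, ρ i)) → 0` when `η` is small. This is impossible, since `E` has positive
measure in every ball centred at a point of `closure (X \ E⁰)` (`IsBVExtensionSet.exists_density_step`).

The isoperimetric inequality (`exists_twoSet_isoperimetric`) is stated without powers. For `A` and
`Z` in `B (x, R)`, a function equal to `1` on `A` and `0` on `Z`, with total variation less than
`D`, satisfies one of `μ (B (x, R)) ≤ Bⁿ C R D`, `2ⁿ μ A ≤ C R D`, `2ⁿ μ Z ≤ C R D`, where `n` is
arbitrary and `B` depends on the doubling constant. In the iteration `n` grows linearly with the
step, which replaces the Sobolev exponent. For a locally Lipschitz function it follows from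
telescoping the mean values over the balls `B (y, 4⁻ᵏ R)` (`exists_scale_of_oscillation`) and the
Vitali covering lemma (`DoublingWith.measure_le_lintegral_of_cover`). The passage to `BV` uses
convergence in measure on balls; these are relatively compact because a complete doubling space is
proper (`DoublingWith.properSpace`).
-/

namespace MetricBV

/-! ### Local Lipschitz constants, doubling measures and mean values -/

variable {X : Type*} [MetricSpace X]

theorem lip_le_of_lipschitzWith {u : X → ℝ} {L : ℝ≥0} (hu : LipschitzWith L u) (x : X) :
    lip u x ≤ L := by
  refine limsup_le_of_le (by isBoundedDefault) (Eventually.of_forall fun y => ?_)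
  exact ENNReal.div_le_of_le_mul (hu y x)

theorem lip_eq_zero_of_eventually_eq {u : X → ℝ} {x : X} (h : ∀ᶠ y in 𝓝 x, u y = u x) :
    lip u x = 0 := by
  have : (fun y => edist (u y) (u x) / edist y x) =ᶠ[𝓝[≠] x] fun _ => 0 :=
    (eventually_nhdsWithin_of_eventually_nhds h).mono fun y hy => by simp [hy]
  rw [lip, limsup_congr this]
  exact le_antisymm (limsup_le_of_le (by isBoundedDefault) (by simp)) zero_le

variable [MeasurableSpace X]

/-- `μ` is doubling with constant `K ≥ 1`, and balls have positive finite measure. -/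
structure DoublingWith (μ : Measure X) (K : ℝ≥0) : Prop where
  one_le : 1 ≤ K
  pos : ∀ (x : X) (r : ℝ), 0 < r → 0 < μ (ball x r)
  lt_top : ∀ (x : X) (r : ℝ), μ (ball x r) < ∞
  double : ∀ (x : X) (r : ℝ), 0 < r → μ (ball x (2 * r)) ≤ K * μ (ball x r)

/-- The `(1,1)`-Poincaré inequality with constant `C` and dilation factor `Λ`. -/
structure PoincareWith (μ : Measure X) (C Λ : ℝ) : Prop where
  pos : 0 < C
  one_le : 1 ≤ Λ
  ineq : ∀ u : X → ℝ, LocallyLipschitz u → ∀ (x : X) (r : ℝ), 0 < r →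
      (⨍⁻ y in ball x r, ‖u y - ⨍ z in ball x r, u z ∂μ‖ₑ ∂μ) ≤
        ENNReal.ofReal (C * r) * ⨍⁻ y in ball x (Λ * r), lip u y ∂μ

theorem IsDoubling.exists_doublingWith {μ : Measure X} (h : IsDoubling μ) :
    ∃ K : ℝ≥0, DoublingWith μ K := by
  obtain ⟨C, hC, h⟩ := h
  have hpos : ∀ (x : X) (r : ℝ), 0 < r → 0 < μ (ball x r) := fun x r hr => by
    have := (h x (r / 2) (by positivity)).1
    rwa [mul_div_cancel₀ r (two_ne_zero)] at this
  refine ⟨max C 1, le_max_right _ _, hpos, fun x r => ?_, fun x r hr => ?_⟩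
  · rcases le_or_gt r 0 with hr | hr
    · simp [ball_eq_empty.2 hr]
    · exact ENNReal.lt_top_of_mul_ne_top_right (h x r hr).2.2.ne (by simpa using hC.ne')
  · refine (h x r hr).2.1.trans ?_
    gcongr
    exact le_max_left _ _

theorem SupportsPoincare.exists_poincareWith {μ : Measure X} (h : SupportsPoincare μ) :
    ∃ C Λ : ℝ, PoincareWith μ C Λ := by
  obtain ⟨C, Λ, h1, h2, h3⟩ := h
  exact ⟨C, Λ, h1, h2, h3⟩

namespace DoublingWith

variable {μ : Measure X} {K : ℝ≥0}

theorem double_pow (h : DoublingWith μ K) (x : X) {r : ℝ} (hr : 0 < r) (n : ℕ) :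
    μ (ball x (2 ^ n * r)) ≤ (K : ℝ≥0∞) ^ n * μ (ball x r) := by
  induction n with
  | zero => simp
  | succ n ih =>
    calc μ (ball x (2 ^ (n + 1) * r)) = μ (ball x (2 * (2 ^ n * r))) := by ring_nf
      _ ≤ K * μ (ball x (2 ^ n * r)) := h.double x _ (by positivity)
      _ ≤ K * ((K : ℝ≥0∞) ^ n * μ (ball x r)) := by gcongr
      _ = _ := by ring

/-- Comparison of balls with different centres. -/
theorem measure_ball_le (h : DoublingWith μ K) {x y : X} {r s : ℝ} (hs : 0 < s) (n : ℕ)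
    (hn : r + dist x y ≤ 2 ^ n * s) : μ (ball x r) ≤ (K : ℝ≥0∞) ^ n * μ (ball y s) :=
  (measure_mono (ball_subset_ball' hn)).trans (h.double_pow y hs n)

theorem one_le_coe (h : DoublingWith μ K) : (1 : ℝ≥0∞) ≤ K := by
  exact_mod_cast h.one_le

/-- A complete space carrying a doubling measure is proper: a maximal family of disjoint balls of
radius `ε` inside a ball is finite, since their measures are bounded below. -/
theorem properSpace [BorelSpace X] [CompleteSpace X] (h : DoublingWith μ K) : ProperSpace X := by
  refine ProperSpace.of_isCompact_closedBall_of_le 0 fun z R hR => ?_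
  refine isCompact_iff_totallyBounded_isComplete.2 ⟨?_, isClosed_closedBall.isComplete⟩
  refine Metric.totallyBounded_iff.2 fun ε hε => ?_
  obtain ⟨u, hut, hdisj, hcov⟩ := Vitali.exists_disjoint_subfamily_covering_enlargement_closedBall
    (closedBall z R) (fun x => x) (fun _ => ε / 8) (ε / 8) (fun _ _ => le_rfl) 4 (by norm_num)
  obtain ⟨n, hn⟩ : ∃ n : ℕ, (R + 1) / (ε / 8) < 2 ^ n := pow_unbounded_of_one_lt _ (by norm_num)
  have hn' : R + 1 ≤ 2 ^ n * (ε / 8) := by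
    rw [div_lt_iff₀ (by positivity)] at hn
    exact hn.le
  -- every ball of the family, enlarged `2 ^ n` times, contains `ball z 1`
  have hlow : ∀ b ∈ u, μ (ball z 1) / (K : ℝ≥0∞) ^ n ≤ μ (closedBall b (ε / 8)) := fun b hb => by
    refine ENNReal.div_le_of_le_mul' ?_
    refine (h.measure_ball_le (by positivity) n ?_).trans
      (mul_le_mul_right (measure_mono ball_subset_closedBall) _)
    have := mem_closedBall'.1 (hut hb)
    linarith
  have hfin : u.Finite := by
    have := Measure.finite_const_le_meas_of_disjoint_iUnion μ
      (ε := μ (ball z 1) / (K : ℝ≥0∞) ^ n)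
      (ENNReal.div_pos (h.pos z 1 one_pos).ne' (by finiteness))
      (As := fun b : u => closedBall (b : X) (ε / 8)) (fun _ => measurableSet_closedBall)
      (fun a b hab => hdisj a.2 b.2 (fun e => hab (Subtype.ext e))) ?_
    · have hu : {i : u | μ (ball z 1) / (K : ℝ≥0∞) ^ n ≤ μ (closedBall (i : X) (ε / 8))}
          = Set.univ := Set.eq_univ_of_forall fun b => hlow b b.2
      rw [hu] at this
      exact Set.finite_coe_iff.1 (Set.finite_univ_iff.1 this)
    · refine ((measure_mono (Set.iUnion_subset fun b => ?_)).trans_lt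
        (h.lt_top z (R + ε))).ne
      refine fun y hy => mem_ball.2 ?_
      have h1 := mem_closedBall.1 (hut b.2)
      have h2 := mem_closedBall.1 hy
      linarith [dist_triangle y b z]
  refine ⟨u, hfin, fun a ha => ?_⟩
  obtain ⟨b, hb, hab⟩ := hcov a ha
  refine Set.mem_biUnion hb (mem_ball.2 ?_)
  have := mem_closedBall.1 (hab (mem_closedBall_self (by positivity)))
  linarith

end DoublingWith

section Means

theorem enorm_setAverage_sub_le {X : Type*} [MeasurableSpace X] {μ : Measure X} {w : X → ℝ}
    {s : Set X} (hs0 : μ s ≠ 0) (hs : μ s ≠ ∞)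
    (hw : IntegrableOn w s μ) (c : ℝ) :
    μ s * ‖(⨍ y in s, w y ∂μ) - c‖ₑ ≤ ∫⁻ y in s, ‖w y - c‖ₑ ∂μ := by
  have hc : (⨍ y in s, w y ∂μ) - c = ⨍ y in s, (w y - c) ∂μ := by
    have : IsFiniteMeasure (μ.restrict s) := isFiniteMeasure_restrict.2 hs
    have h1 : μ.real s ≠ 0 := (ENNReal.toReal_pos hs0 hs).ne'
    simp only [setAverage_eq, smul_eq_mul]
    rw [integral_sub hw (integrable_const c)]
    simp
    field_simp
  rw [hc, mul_comm, ← ENNReal.le_div_iff_mul_le (Or.inl hs0) (Or.inl hs), ← setLAverage_eq]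
  exact enorm_integral_le_lintegral_enorm _

variable {μ : Measure X}

theorem integrableOn_ball [BorelSpace X] [ProperSpace X] {K : ℝ≥0} (hd : DoublingWith μ K)
    {w : X → ℝ} (hw : Continuous w) (x : X) (r : ℝ) : IntegrableOn w (ball x r) μ := by
  refine IntegrableOn.mono_set ?_ (ball_subset_closedBall (x := x) (ε := r))
  have hfin : μ (closedBall x r) < ∞ :=
    (measure_mono (closedBall_subset_ball (lt_add_one r))).trans_lt (hd.lt_top x _)
  obtain ⟨C, hC⟩ := (isCompact_closedBall x r).exists_bound_of_continuousOn hw.continuousOn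
  exact Measure.integrableOn_of_bounded hfin.ne
    (hw.stronglyMeasurable.aestronglyMeasurable) (M := C)
    ((ae_restrict_iff' measurableSet_closedBall).2 (Eventually.of_forall hC))

/-- The mean values of `w` on two nested balls of comparable size differ by at most a multiple of
`r ∫ lip w / μ (B)`. -/
theorem enorm_setAverage_sub_setAverage_le [BorelSpace X] [ProperSpace X] {K : ℝ≥0}
    (hd : DoublingWith μ K) {C Λ : ℝ} (hP : PoincareWith μ C Λ) {w : X → ℝ}
    (hw : LocallyLipschitz w) {x y : X} {r s : ℝ} (hs : 0 < s) (h1 : ball y s ⊆ ball x r) (h2 : r + dist x y ≤ 2 ^ 2 * s) :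
    μ (ball x r) * ‖(⨍ z in ball y s, w z ∂μ) - ⨍ z in ball x r, w z ∂μ‖ₑ ≤
      (K : ℝ≥0∞) ^ 2 * ENNReal.ofReal (C * r) * ∫⁻ z in ball x (Λ * r), lip w z ∂μ := by
  have hr : 0 < r := by
    by_contra hr
    exact Set.notMem_empty y ((ball_eq_empty (x := x)).2 (not_lt.1 hr) ▸ h1 (mem_ball_self hs))
  have hΛr : r ≤ Λ * r := le_mul_of_one_le_left hr.le hP.one_le
  calc
    _ ≤ (K : ℝ≥0∞) ^ 2 * μ (ball y s) *
          ‖(⨍ z in ball y s, w z ∂μ) - ⨍ z in ball x r, w z ∂μ‖ₑ := by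
        gcongr; exact hd.measure_ball_le hs 2 h2
    _ ≤ (K : ℝ≥0∞) ^ 2 * ∫⁻ z in ball x r, ‖w z - ⨍ z in ball x r, w z ∂μ‖ₑ ∂μ := by
        rw [mul_assoc]
        gcongr
        exact (enorm_setAverage_sub_le (hd.pos y s hs).ne' (hd.lt_top y s).ne
          (integrableOn_ball hd hw.continuous y s) _).trans (lintegral_mono_set h1)
    _ ≤ (K : ℝ≥0∞) ^ 2 * (μ (ball x r) * (ENNReal.ofReal (C * r) *
          ((∫⁻ z in ball x (Λ * r), lip w z ∂μ) / μ (ball x (Λ * r))))) := by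
        gcongr
        have := hP.ineq w hw x r hr
        rwa [setLAverage_eq, setLAverage_eq, ENNReal.div_le_iff' (hd.pos x r hr).ne'
          (hd.lt_top x r).ne] at this
    _ ≤ (K : ℝ≥0∞) ^ 2 * (ENNReal.ofReal (C * r) * ∫⁻ z in ball x (Λ * r), lip w z ∂μ) := by
        rw [mul_left_comm (μ (ball x r))]
        refine mul_le_mul_right (mul_le_mul_right ?_ _) _
        exact (mul_le_mul_left (measure_mono (ball_subset_ball hΛr)) _).trans
          ENNReal.mul_div_le
    _ = _ := by ring

/-- Mean values on small balls converge to the value of a continuous function. -/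
theorem tendsto_setAverage_ball [BorelSpace X] [ProperSpace X] {K : ℝ≥0} (hd : DoublingWith μ K)
    {w : X → ℝ} (hw : Continuous w) (y : X) {ρ : ℕ → ℝ} (hρ : ∀ n, 0 < ρ n)
    (hρ0 : Tendsto ρ atTop (𝓝 0)) :
    Tendsto (fun n => ⨍ z in ball y (ρ n), w z ∂μ) atTop (𝓝 (w y)) := by
  refine Metric.tendsto_nhds.2 fun ε hε => ?_
  obtain ⟨δ, hδ, hδw⟩ := Metric.continuousAt_iff.1 hw.continuousAt (ε / 2) (half_pos hε)
  filter_upwards [hρ0.eventually (gt_mem_nhds hδ)] with n hn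
  have hm := hd.lt_top y (ρ n)
  have hm0 := hd.pos y (ρ n) (hρ n)
  have h1 := enorm_setAverage_sub_le hm0.ne' hm.ne (integrableOn_ball hd hw y (ρ n)) (w y)
  have h2 : ∫⁻ z in ball y (ρ n), ‖w z - w y‖ₑ ∂μ ≤
      ∫⁻ _ in ball y (ρ n), ENNReal.ofReal (ε / 2) ∂μ := by
    refine setLIntegral_mono measurable_const fun z hz => ?_
    rw [← ofReal_norm, ← dist_eq_norm]
    exact ENNReal.ofReal_le_ofReal (hδw ((mem_ball.1 hz).trans hn)).le
  rw [setLIntegral_const, mul_comm (ENNReal.ofReal _)] at h2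
  have h3 := (ENNReal.mul_le_mul_iff_right hm0.ne' hm.ne).1 (h1.trans h2)
  rw [← ofReal_norm, ENNReal.ofReal_le_ofReal_iff (by positivity)] at h3
  rw [dist_eq_norm]
  linarith

end Means

end MetricBV

namespace MetricBV

/-! ### The isoperimetric inequality for locally Lipschitz functions -/

variable {X : Type*} [MetricSpace X] [MeasurableSpace X]

section Isoperimetric

variable [BorelSpace X] [ProperSpace X] {μ : Measure X} {K : ℝ≥0}

/-- Vitali covering argument: if every point `y` of `G` is the centre of a ball whose measure is
controlled by the integral of `f` over a dilated ball, then `μ G` is controlled by `∫ f`. -/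
theorem DoublingWith.measure_le_lintegral_of_cover (hd : DoublingWith μ K) {G : Set X} {R Λ : ℝ}
    {ρ : X → ℝ} (hρ : ∀ y ∈ G, 0 < ρ y) (hρR : ∀ y ∈ G, ρ y ≤ R) (hΛ : 1 ≤ Λ) {f : X → ℝ≥0∞}
    {a b : ℝ≥0∞} {L : ℕ} (hL : 5 * Λ ≤ 2 ^ L)
    (h : ∀ y ∈ G, a * μ (ball y (ρ y)) ≤ b * ∫⁻ z in ball y (Λ * ρ y), f z ∂μ) :
    a * μ G ≤ (K : ℝ≥0∞) ^ L * b * ∫⁻ z, f z ∂μ := by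
  have hΛ0 : 0 < Λ := by linarith
  obtain ⟨u, huG, hdisj, hcov⟩ := Vitali.exists_disjoint_subfamily_covering_enlargement_closedBall
    G (fun x => x) (fun y => Λ * ρ y) (Λ * R)
    (fun y hy => mul_le_mul_of_nonneg_left (hρR y hy) hΛ0.le) 4 (by norm_num)
  have hdisj' : u.PairwiseDisjoint fun y => ball y (Λ * ρ y) := fun y hy z hz hyz =>
    (hdisj hy hz hyz).mono ball_subset_closedBall ball_subset_closedBall
  have hcount : u.Countable := hdisj'.countable_of_isOpen (fun _ _ => isOpen_ball)
    fun y hy => nonempty_ball.2 (mul_pos hΛ0 (hρ y (huG hy)))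
  have hGsub : G ⊆ ⋃ y ∈ u, ball y (2 ^ L * ρ y) := fun y hy => by
    obtain ⟨z, hz, hyz⟩ := hcov y hy
    refine Set.mem_biUnion hz (mem_ball.2 ?_)
    have h1 := mem_closedBall.1 (hyz (mem_closedBall_self (mul_pos hΛ0 (hρ y hy)).le))
    have h2 := hρ z (huG hz)
    nlinarith [mul_pos hΛ0 h2]
  calc a * μ G ≤ a * ∑' y : u, μ (ball (y : X) (2 ^ L * ρ y)) := by
        gcongr
        exact (measure_mono hGsub).trans (measure_biUnion_le μ hcount _)
    _ = ∑' y : u, a * μ (ball (y : X) (2 ^ L * ρ y)) := ENNReal.tsum_mul_left.symm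
    _ ≤ ∑' y : u, (K : ℝ≥0∞) ^ L * b * ∫⁻ z in ball (y : X) (Λ * ρ y), f z ∂μ := by
        refine ENNReal.tsum_le_tsum fun y => ?_
        calc _ ≤ a * ((K : ℝ≥0∞) ^ L * μ (ball (y : X) (ρ y))) := by
              gcongr; exact hd.double_pow _ (hρ y (huG y.2)) L
          _ = (K : ℝ≥0∞) ^ L * (a * μ (ball (y : X) (ρ y))) := by ring
          _ ≤ (K : ℝ≥0∞) ^ L * (b * ∫⁻ z in ball (y : X) (Λ * ρ y), f z ∂μ) := by
              exact mul_le_mul_right (h y (huG y.2)) _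
          _ = _ := by ring
    _ = (K : ℝ≥0∞) ^ L * b * ∫⁻ z in ⋃ y ∈ u, ball y (Λ * ρ y), f z ∂μ := by
        rw [ENNReal.tsum_mul_left, lintegral_biUnion hcount (fun _ _ => measurableSet_ball) hdisj']
    _ ≤ _ := by gcongr; exact Measure.restrict_le_self

/-- Telescoping over the balls `B (y, 4⁻ᵏ R)`: if `w y` is far from the mean value of `w` on
`B (x, 2R)`, then `lip w` has a large integral on the whole space or on a dilation of one of these
balls. The factor `2 ^ k` is the gain of the telescoping with ratio `4` against weights `2⁻ᵏ`. -/
theorem exists_scale_of_oscillation (hd : DoublingWith μ K) {C Λ : ℝ} (hP : PoincareWith μ C Λ)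
    {w : X → ℝ} (hw : LocallyLipschitz w) {x y : X} {R : ℝ} (hR : 0 < R) (hy : y ∈ ball x R)
    (hosc : 1 / 4 ≤ |w y - ⨍ z in ball x (2 * R), w z ∂μ|) :
    μ (ball x R) ≤ 64 * (K : ℝ≥0∞) ^ 2 * ENNReal.ofReal C * ENNReal.ofReal R * ∫⁻ z, lip w z ∂μ ∨
    ∃ k : ℕ, 2 ^ k * μ (ball y (R / 4 ^ k)) ≤
      64 * (K : ℝ≥0∞) ^ 2 * ENNReal.ofReal C * ENNReal.ofReal R *
        ∫⁻ z in ball y (Λ * (R / 4 ^ k)), lip w z ∂μ := by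
  have hxy := mem_ball.1 hy
  set c := ⨍ z in ball x (2 * R), w z ∂μ with hc
  set a : ℕ → ℝ := fun k => ⨍ z in ball y (R / 4 ^ k), w z ∂μ with ha
  by_cases h0 : 1 / 8 ≤ |a 0 - c|
  · left
    have h1 := enorm_setAverage_sub_setAverage_le hd hP hw (x := x) (y := y) (r := 2 * R) (s := R)
      hR (ball_subset_ball' (by linarith)) (by rw [dist_comm]; linarith)
    have ha0 : a 0 = ⨍ z in ball y R, w z ∂μ := by simp [ha]
    rw [← hc, ← ha0, Real.enorm_eq_ofReal_abs] at h1
    have h2 : (1 : ℝ≥0∞) ≤ 8 * ENNReal.ofReal |a 0 - c| := by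
      rw [← ENNReal.ofReal_one, ← ENNReal.ofReal_ofNat, ← ENNReal.ofReal_mul (by norm_num)]
      exact ENNReal.ofReal_le_ofReal (by linarith)
    calc μ (ball x R) ≤ μ (ball x (2 * R)) * 1 := by
          rw [mul_one]; exact measure_mono (ball_subset_ball (by linarith))
      _ ≤ μ (ball x (2 * R)) * (8 * ENNReal.ofReal |a 0 - c|) := by gcongr
      _ = 8 * (μ (ball x (2 * R)) * ENNReal.ofReal |a 0 - c|) := by ring
      _ ≤ 8 * ((K : ℝ≥0∞) ^ 2 * ENNReal.ofReal (C * (2 * R)) * ∫⁻ z, lip w z ∂μ) := by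
          refine mul_le_mul_right (h1.trans (mul_le_mul_right ?_ _)) _
          exact lintegral_mono' Measure.restrict_le_self le_rfl
      _ = 16 * (K : ℝ≥0∞) ^ 2 * ENNReal.ofReal C * ENNReal.ofReal R * ∫⁻ z, lip w z ∂μ := by
          rw [ENNReal.ofReal_mul hP.pos.le, ENNReal.ofReal_mul (by norm_num), ENNReal.ofReal_ofNat]
          ring
      _ ≤ _ := by gcongr; norm_num
  · right
    by_contra! hk
    have hstep : ∀ k, dist (a k) (a (k + 1)) ≤ 1 / 64 * (1 / 2 : ℝ) ^ k := fun k => by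
      have h1 := enorm_setAverage_sub_setAverage_le hd hP hw (x := y) (y := y) (r := R / 4 ^ k)
        (s := R / 4 ^ (k + 1)) (by positivity)
        (ball_subset_ball (by gcongr <;> norm_num)) (by
          rw [dist_self, pow_succ]
          apply le_of_eq
          field_simp
          ring)
      have hm0 := hd.pos y (R / 4 ^ k) (by positivity)
      have hm := hd.lt_top y (R / 4 ^ k)
      have h4 : (4 : ℝ≥0∞) ^ k * ENNReal.ofReal (C * (R / 4 ^ k)) =
          ENNReal.ofReal C * ENNReal.ofReal R := by
        rw [← ENNReal.ofReal_ofNat, ← ENNReal.ofReal_pow (by norm_num),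
          ← ENNReal.ofReal_mul (by positivity), ← ENNReal.ofReal_mul hP.pos.le]
        congr 1
        field_simp
      have h2 : μ (ball y (R / 4 ^ k)) * (64 * 4 ^ k * ENNReal.ofReal |a (k + 1) - a k|) ≤
          μ (ball y (R / 4 ^ k)) * 2 ^ k := by
        rw [Real.enorm_eq_ofReal_abs] at h1
        calc _ = 64 * 4 ^ k * (μ (ball y (R / 4 ^ k)) * ENNReal.ofReal |a (k + 1) - a k|) := by ring
          _ ≤ 64 * 4 ^ k * ((K : ℝ≥0∞) ^ 2 * ENNReal.ofReal (C * (R / 4 ^ k)) *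
              ∫⁻ z in ball y (Λ * (R / 4 ^ k)), lip w z ∂μ) := by gcongr
          _ = 64 * (K : ℝ≥0∞) ^ 2 * (4 ^ k * ENNReal.ofReal (C * (R / 4 ^ k))) *
              ∫⁻ z in ball y (Λ * (R / 4 ^ k)), lip w z ∂μ := by ring
          _ ≤ _ := by
            rw [h4, mul_comm _ (2 ^ k)]
            exact le_of_eq_of_le (by ring) (hk k).le
      have h3 := (ENNReal.mul_le_mul_iff_right hm0.ne' hm.ne).1 h2
      rw [← ENNReal.ofReal_ofNat, ← ENNReal.ofReal_ofNat, ← ENNReal.ofReal_ofNat,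
        ← ENNReal.ofReal_pow (by norm_num), ← ENNReal.ofReal_pow (by norm_num),
        ← ENNReal.ofReal_mul (by norm_num), ← ENNReal.ofReal_mul (by positivity),
        ENNReal.ofReal_le_ofReal_iff (by positivity)] at h3
      rw [dist_comm, Real.dist_eq]
      have h5 : (4 : ℝ) ^ k = 2 ^ k * 2 ^ k := by rw [← mul_pow]; norm_num
      rw [h5] at h3
      have h6 : (0 : ℝ) < 2 ^ k := by positivity
      have h7 : (1 / 2 : ℝ) ^ k * 2 ^ k = 1 := by rw [← mul_pow]; norm_num
      have h8 : 64 * 2 ^ k * |a (k + 1) - a k| ≤ 1 := by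
        refine le_of_mul_le_mul_left ?_ h6
        linarith
      refine le_of_mul_le_mul_left ?_ h6
      linarith
    have hlim : Tendsto a atTop (𝓝 (w y)) :=
      tendsto_setAverage_ball hd hw.continuous y (fun n => by positivity)
        (tendsto_const_nhds.div_atTop (tendsto_pow_atTop_atTop_of_one_lt (by norm_num)))
    have h1 := dist_le_of_le_geometric_of_tendsto₀ _ _ (by norm_num) hstep hlim
    rw [Real.dist_eq, abs_sub_comm] at h1
    have h2 := abs_sub_le (w y) (a 0) c
    norm_num at h1
    linarith

/-- A set `G` in `B (x, R)` on which `w` stays far from its mean value is small compared with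
`R ∫ lip w`, with the gain `2⁻ⁿ`, unless `R ∫ lip w` exceeds a definite part of `μ (B (x, R))`. -/
theorem exists_measure_le_of_oscillation (hd : DoublingWith μ K) {C Λ : ℝ}
    (hP : PoincareWith μ C Λ) : ∃ C₁ : ℝ≥0, ∀ (w : X → ℝ), LocallyLipschitz w →
      ∀ (x : X) (R : ℝ), 0 < R → ∀ (n : ℕ) (G : Set X), G ⊆ ball x R →
      (∀ y ∈ G, 1 / 4 ≤ |w y - ⨍ z in ball x (2 * R), w z ∂μ|) →
      μ (ball x R) ≤ ((K : ℝ≥0∞) ^ 2) ^ n * C₁ * ENNReal.ofReal R * ∫⁻ z, lip w z ∂μ ∨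
      2 ^ n * μ G ≤ C₁ * ENNReal.ofReal R * ∫⁻ z, lip w z ∂μ := by
  -- `2 ^ L` absorbs the dilation `Λ` of the Poincaré inequality and the Vitali enlargement
  obtain ⟨L, hL⟩ : ∃ L : ℕ, 5 * Λ < 2 ^ L := pow_unbounded_of_one_lt _ (by norm_num)
  set c : ℝ≥0∞ := 64 * (K : ℝ≥0∞) ^ 2 * ENNReal.ofReal C with hc
  have hKL : (1 : ℝ≥0∞) ≤ (K : ℝ≥0∞) ^ L := one_le_pow₀ hd.one_le_coe
  have hK2 : (1 : ℝ≥0∞) ≤ (K : ℝ≥0∞) ^ 2 := one_le_pow₀ hd.one_le_coe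
  have hcoe : (((K : ℝ≥0∞) ^ L * c).toNNReal : ℝ≥0∞) = (K : ℝ≥0∞) ^ L * c :=
    ENNReal.coe_toNNReal (by rw [hc]; finiteness)
  refine ⟨((K : ℝ≥0∞) ^ L * c).toNNReal, fun w hw x R hR n G hG hosc => ?_⟩
  rw [hcoe, or_iff_not_imp_left, not_le]
  intro hbig
  have hbig' : ((K : ℝ≥0∞) ^ 2) ^ n * (c * ENNReal.ofReal R * ∫⁻ z, lip w z ∂μ) <
      μ (ball x R) := by
    refine lt_of_le_of_lt ?_ hbig
    calc _ = ((K : ℝ≥0∞) ^ 2) ^ n * (1 * c) * ENNReal.ofReal R * ∫⁻ z, lip w z ∂μ := by ring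
      _ ≤ _ := by gcongr
  have hscale : ∀ y ∈ G, ∃ ρ : ℝ, 0 < ρ ∧ ρ ≤ R ∧ 2 ^ n * μ (ball y ρ) ≤
      c * ENNReal.ofReal R * ∫⁻ z in ball y (Λ * ρ), lip w z ∂μ := by
    intro y hy
    have hxy := mem_ball.1 (hG hy)
    rcases exists_scale_of_oscillation hd hP hw hR (hG hy) (hosc y hy) with h | ⟨k, hk⟩
    · refine absurd hbig' (not_lt.2 (h.trans ?_))
      exact le_mul_of_one_le_left' (one_le_pow₀ hK2)
    · rcases lt_or_ge k n with hkn | hkn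
      -- a ball of scale `k < n` has a definite part of the measure of `ball x R`
      · refine absurd hbig' (not_lt.2 ?_)
        calc μ (ball x R) ≤ (K : ℝ≥0∞) ^ (2 * (k + 1)) * μ (ball y (R / 4 ^ k)) := by
              refine hd.measure_ball_le (by positivity) _ ?_
              rw [pow_mul, pow_succ, dist_comm]
              norm_num
              field_simp
              linarith
          _ ≤ ((K : ℝ≥0∞) ^ 2) ^ n * (2 ^ k * μ (ball y (R / 4 ^ k))) := by
              rw [pow_mul]
              exact mul_le_mul' (pow_le_pow_right₀ hK2 hkn)
                (le_mul_of_one_le_left' (one_le_pow₀ one_le_two))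
          _ ≤ _ := by
              refine mul_le_mul_right (hk.trans ?_) _
              gcongr
              exact Measure.restrict_le_self
      · refine ⟨R / 4 ^ k, by positivity, ?_, le_trans ?_ hk⟩
        · exact div_le_self hR.le (one_le_pow₀ (by norm_num))
        · gcongr
          exact one_le_two
  choose! ρ hρ0 hρR hρ using hscale
  have := hd.measure_le_lintegral_of_cover hρ0 hρR hP.one_le hL.le hρ
  exact this.trans_eq (by ring)

/-- Two-set isoperimetric inequality: a locally Lipschitz function that is at least `3/4` on `A` and
at most `1/4` on `Z`, with `A` and `Z` in `B (x, R)`, has large energy. The free parameter `n`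
trades the alternatives against each other and takes the place of a Sobolev exponent. -/
theorem exists_twoSet_isoperimetric_of_locallyLipschitz (hd : DoublingWith μ K) {C Λ : ℝ}
    (hP : PoincareWith μ C Λ) : ∃ C₁ : ℝ≥0, ∀ (w : X → ℝ), LocallyLipschitz w →
      ∀ (x : X) (R : ℝ), 0 < R → ∀ (n : ℕ) (A Z : Set X), A ⊆ ball x R → Z ⊆ ball x R →
      (∀ y ∈ A, 3 / 4 ≤ w y) → (∀ y ∈ Z, w y ≤ 1 / 4) →
      μ (ball x R) ≤ ((K : ℝ≥0∞) ^ 2) ^ n * C₁ * ENNReal.ofReal R * ∫⁻ z, lip w z ∂μ ∨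
      2 ^ n * μ A ≤ C₁ * ENNReal.ofReal R * ∫⁻ z, lip w z ∂μ ∨
      2 ^ n * μ Z ≤ C₁ * ENNReal.ofReal R * ∫⁻ z, lip w z ∂μ := by
  obtain ⟨C₁, h⟩ := exists_measure_le_of_oscillation hd hP
  refine ⟨C₁, fun w hw x R hR n A Z hA hZ hwA hwZ => ?_⟩
  -- the mean value is at distance at least `1/4` from the values on `A` or from those on `Z`
  rcases le_total (⨍ z in ball x (2 * R), w z ∂μ) (1 / 2) with hm | hm
  · refine (h w hw x R hR n A hA fun y hy => ?_).imp_right Or.inl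
    rw [le_abs]
    left
    linarith [hwA y hy]
  · refine (h w hw x R hR n Z hZ fun y hy => ?_).imp_right Or.inr
    rw [le_abs]
    right
    linarith [hwZ y hy]

end Isoperimetric

end MetricBV

namespace MetricBV

variable {X : Type*} [MetricSpace X] [MeasurableSpace X]

/-! ### The isoperimetric inequality for functions of bounded variation -/

section BVIsoperimetric

variable [BorelSpace X] [ProperSpace X] {μ : Measure X} {K : ℝ≥0}

omit [BorelSpace X] in
/-- In a proper space, `L¹_loc` convergence is convergence in `L¹` of every closed ball. -/
theorem TendstoL1Loc.tendsto_closedBall {v : ℕ → X → ℝ} {u : X → ℝ}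
    (h : TendstoL1Loc μ Set.univ v u) (x : X) (r : ℝ) :
    Tendsto (fun n => ∫⁻ y in closedBall x r, ‖v n y - u y‖ₑ ∂μ) atTop (𝓝 0) := by
  refine (isCompact_closedBall x r).induction_on
    (p := fun s => Tendsto (fun n => ∫⁻ y in s, ‖v n y - u y‖ₑ ∂μ) atTop (𝓝 0)) ?_ ?_ ?_ ?_
  · simp
  · exact fun s t hst ht => tendsto_of_tendsto_of_tendsto_of_le_of_le tendsto_const_nhds ht
      (fun _ => zero_le) fun n => lintegral_mono_set hst
  · intro s t hs ht
    have := hs.add ht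
    rw [add_zero] at this
    exact tendsto_of_tendsto_of_tendsto_of_le_of_le tendsto_const_nhds this
      (fun _ => zero_le) fun n => lintegral_union_le _ s t
  · intro y _
    obtain ⟨U, hU, hlim⟩ := h y (Set.mem_univ y)
    exact ⟨U, mem_nhdsWithin_of_mem_nhds hU, by simpa using hlim⟩

/-- If `v n → u` in `L¹_loc` and `u = c` on `A`, then `v n` is eventually close to `c` on at least
half of `A`. -/
theorem TendstoL1Loc.eventually_measure_le {v : ℕ → X → ℝ} {u : X → ℝ}
    (h : TendstoL1Loc μ Set.univ v u) (hv : ∀ n, AEMeasurable (v n) μ) (hu : AEMeasurable u μ)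
    {x : X} {R : ℝ} {A : Set X} (hA : A ⊆ ball x R) (hAfin : μ A ≠ ∞) {c : ℝ}
    (huA : ∀ᵐ y ∂μ, y ∈ A → u y = c) :
    ∀ᶠ n in atTop, μ A ≤ 2 * μ {y ∈ A | |v n y - c| ≤ 1 / 4} := by
  rcases eq_or_ne (μ A) 0 with h0 | h0
  · simp [h0]
  have hlt : 0 < μ A / 8 := ENNReal.div_pos h0 (by norm_num)
  filter_upwards [(h.tendsto_closedBall x R).eventually (gt_mem_nhds hlt)] with n hn
  set S := closedBall x R
  have hmark := mul_meas_ge_le_lintegral₀ (μ := μ.restrict S) (f := fun y => ‖v n y - u y‖ₑ)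
    ((hv n).sub hu).enorm.restrict (1 / 4)
  rw [Measure.restrict_apply' measurableSet_closedBall] at hmark
  have hbad : μ {y ∈ A | ¬ |v n y - c| ≤ 1 / 4} ≤
      μ ({y | 1 / 4 ≤ ‖v n y - u y‖ₑ} ∩ S) := by
    refine measure_mono_ae ?_
    filter_upwards [huA] with y hy hyA
    refine ⟨?_, ball_subset_closedBall (hA hyA.1)⟩
    have h1 : ¬ |v n y - c| ≤ 1 / 4 := hyA.2
    rw [Set.mem_ofPred_eq, hy hyA.1, Real.enorm_eq_ofReal_abs]
    have : (1 / 4 : ℝ≥0∞) = ENNReal.ofReal (1 / 4) := by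
      rw [ENNReal.ofReal_div_of_pos (by norm_num)]; simp
    rw [this]
    exact ENNReal.ofReal_le_ofReal (not_le.1 h1).le
  have hbad2 : μ {y ∈ A | ¬ |v n y - c| ≤ 1 / 4} ≤ μ A / 2 := by
    calc _ = 4 * (1 / 4 * μ {y ∈ A | ¬ |v n y - c| ≤ 1 / 4}) := by
          rw [← mul_assoc, ENNReal.mul_div_cancel (by norm_num) (by norm_num), one_mul]
      _ ≤ 4 * (μ A / 8) := by
          refine mul_le_mul_right ?_ _
          exact (mul_le_mul_right hbad _).trans (hmark.trans hn.le)
      _ = μ A / 2 := by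
          rw [← mul_div_assoc, show (8 : ℝ≥0∞) = 4 * 2 by norm_num]
          exact ENNReal.mul_div_mul_left _ _ (by norm_num) (by norm_num)
  have hsplit : μ A ≤ μ {y ∈ A | |v n y - c| ≤ 1 / 4} + μ A / 2 := by
    refine (measure_mono fun y hy => ?_).trans ((measure_union_le _ _).trans
      (add_le_add_right hbad2 _))
    by_cases hy' : |v n y - c| ≤ 1 / 4
    · exact Or.inl ⟨hy, hy'⟩
    · exact Or.inr ⟨hy, hy'⟩
  have hhalf : μ A / 2 ≤ μ {y ∈ A | |v n y - c| ≤ 1 / 4} := by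
    nth_rewrite 1 [← ENNReal.add_halves (μ A)] at hsplit
    exact (ENNReal.add_le_add_iff_right (ENNReal.div_ne_top hAfin (by norm_num))).1 hsplit
  calc μ A = 2 * (μ A / 2) := (ENNReal.mul_div_cancel (by norm_num) (by norm_num)).symm
    _ ≤ _ := by gcongr

/-- Two-set isoperimetric inequality for functions of bounded variation: the inequality for locally
Lipschitz functions, applied to one term of a sequence that nearly realizes the total variation. -/
theorem exists_twoSet_isoperimetric (hd : DoublingWith μ K) {C Λ : ℝ} (hP : PoincareWith μ C Λ) :
    ∃ C₁ : ℝ≥0, ∀ (u : X → ℝ), AEMeasurable u μ →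
      ∀ (x : X) (R : ℝ), 0 < R → ∀ (n : ℕ) (A Z : Set X), A ⊆ ball x R → Z ⊆ ball x R →
      (∀ᵐ y ∂μ, y ∈ A → u y = 1) → (∀ᵐ y ∂μ, y ∈ Z → u y = 0) →
      ∀ D : ℝ≥0∞, totalVariation μ u Set.univ < D →
      μ (ball x R) ≤ ((K : ℝ≥0∞) ^ 2) ^ n * C₁ * ENNReal.ofReal R * D ∨
      2 ^ n * μ A ≤ C₁ * ENNReal.ofReal R * D ∨
      2 ^ n * μ Z ≤ C₁ * ENNReal.ofReal R * D := by
  obtain ⟨C₁, hC₁⟩ := exists_twoSet_isoperimetric_of_locallyLipschitz hd hP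
  refine ⟨2 * C₁, fun u hu x R hR n A Z hA hZ huA huZ D hD => ?_⟩
  simp only [totalVariation, totalVariationOpen, iInf_lt_iff] at hD
  obtain ⟨O, -, hO, v, hv, hconv, hlim⟩ := hD
  obtain rfl : O = Set.univ := Set.univ_subset_iff.1 hO
  have hv' : ∀ n, LocallyLipschitz (v n) := fun n => locallyLipschitzOn_univ.1 (hv n)
  have hvm : ∀ n, AEMeasurable (v n) μ := fun n => (hv' n).continuous.measurable.aemeasurable
  have hfin : ∀ {s : Set X}, s ⊆ ball x R → μ s ≠ ∞ := fun hs =>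
    ((measure_mono hs).trans_lt (hd.lt_top x R)).ne
  obtain ⟨m, hm, hmA, hmZ⟩ :=
    ((frequently_lt_of_liminf_lt (by isBoundedDefault) hlim).and_eventually (
      (hconv.eventually_measure_le hvm hu hA (hfin hA) huA).and
      (hconv.eventually_measure_le hvm hu hZ (hfin hZ) huZ))).exists
  rw [Measure.restrict_univ] at hm
  have key := hC₁ (v m) (hv' m) x R hR n {y ∈ A | |v m y - 1| ≤ 1 / 4}
    {y ∈ Z | |v m y - 0| ≤ 1 / 4} (fun y hy => hA hy.1) (fun y hy => hZ hy.1)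
    (fun y hy => by linarith [(abs_le.1 hy.2).1]) (fun y hy => by linarith [(abs_le.1 hy.2).2])
  have h2 : (C₁ : ℝ≥0∞) ≤ (2 * C₁ : ℝ≥0) := by
    push_cast
    exact le_mul_of_one_le_left' one_le_two
  have aux : ∀ {a b : ℝ≥0∞}, a ≤ 2 * b →
      2 ^ n * b ≤ C₁ * ENNReal.ofReal R * ∫⁻ z, lip (v m) z ∂μ →
      2 ^ n * a ≤ (2 * C₁ : ℝ≥0) * ENNReal.ofReal R * D := fun {a b} hab hb => by
    calc 2 ^ n * a ≤ 2 ^ n * (2 * b) := by gcongr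
      _ = 2 * (2 ^ n * b) := by ring
      _ ≤ 2 * (C₁ * ENNReal.ofReal R * D) := by
        refine mul_le_mul_right (hb.trans ?_) _
        gcongr
      _ = _ := by push_cast; ring
  refine key.imp (fun h => h.trans ?_) (Or.imp (aux hmA) (aux hmZ))
  gcongr

end BVIsoperimetric

/-! ### Connectedness and reverse doubling -/

section ReverseDoubling

variable {μ : Measure X} {K : ℝ≥0}

/-- A locally constant function has vanishing local Lipschitz constant, so the Poincaré inequality
forbids a non-constant one: a space with a Poincaré inequality is connected. -/
theorem PoincareWith.preconnectedSpace [BorelSpace X] [ProperSpace X] (hd : DoublingWith μ K)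
    {C Λ : ℝ} (hP : PoincareWith μ C Λ) : PreconnectedSpace X := by
  refine preconnectedSpace_of_forall_constant fun f hf => ?_
  have hloc : ∀ x, ∀ᶠ y in 𝓝 x, f y = f x := fun x =>
    (hf.continuousAt.tendsto (mem_nhds_discrete.2 rfl : {f x} ∈ 𝓝 (f x)))
  set w : X → ℝ := fun x => if f x then 1 else 0 with hw
  have hwloc : ∀ x, ∀ᶠ y in 𝓝 x, w y = w x := fun x => (hloc x).mono fun y hy => by simp [hw, hy]
  have hlip : LocallyLipschitz w := fun x => by
    refine ⟨0, _, hwloc x, fun y hy z hz => ?_⟩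
    rw [Set.mem_ofPred_eq] at hy hz
    simp [hy, hz]
  have hzero : ∀ x, lip w x = 0 := fun x => lip_eq_zero_of_eventually_eq (hwloc x)
  intro x y
  have hconst : ∀ z ∈ ball x (dist x y + 1), w z = ⨍ z in ball x (dist x y + 1), w z ∂μ := by
    set c := ⨍ z in ball x (dist x y + 1), w z ∂μ
    have hR : 0 < dist x y + 1 := by positivity
    have h1 := hP.ineq w hlip x (dist x y + 1) hR
    simp only [hzero, setLAverage_eq, lintegral_zero, ENNReal.zero_div, mul_zero,
      nonpos_iff_eq_zero, ENNReal.div_eq_zero_iff, (hd.lt_top x _).ne, or_false] at h1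
    have hcont : Continuous fun z => ‖w z - c‖ₑ := (hlip.continuous.sub continuous_const).enorm
    rw [lintegral_eq_zero_iff hcont.measurable] at h1
    have h2 := (ae_restrict_iff' measurableSet_ball).1 h1
    intro z hz
    by_contra hne
    have hopen : IsOpen (ball x (dist x y + 1) ∩ {z | ‖w z - c‖ₑ ≠ 0}) :=
      isOpen_ball.inter (isOpen_ne_fun hcont continuous_const)
    obtain ⟨ε, hε, hsub⟩ := Metric.isOpen_iff.1 hopen z
      ⟨hz, by simpa [sub_eq_zero] using hne⟩
    refine (hd.pos z ε hε).ne' (measure_mono_null hsub (measure_mono_null ?_ h2))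
    intro z hz
    simpa using hz
  have h := (hconst x (mem_ball_self (by positivity))).trans
    (hconst y (mem_ball'.2 (by linarith))).symm
  simp only [hw] at h
  cases hx : f x <;> cases hy : f y <;> simp_all

/-- One step of reverse doubling: a ball centred on the sphere of radius `r` is disjoint from
`B (x, r / 2)` and contributes a definite part of the measure. -/
theorem DoublingWith.add_measure_ball_le [BorelSpace X] [PreconnectedSpace X]
    (hd : DoublingWith μ K) {x z : X} {r : ℝ} (hr : 0 < r) (hz : r ≤ dist x z) :
    ((K : ℝ≥0∞) ^ 3 + 1) * μ (ball x (r / 2)) ≤ (K : ℝ≥0∞) ^ 3 * μ (ball x (2 * r)) := by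
  obtain ⟨y, hy⟩ : ∃ y, dist x y = r := by
    have := mem_range_of_exists_le_of_exists_ge (f := fun y => dist x y) (c := r) (by fun_prop)
      ⟨x, by simpa using hr.le⟩ ⟨z, hz⟩
    simpa using this
  have hdisj : Disjoint (ball x (r / 2)) (ball y (r / 2)) :=
    ball_disjoint_ball (by rw [hy]; linarith)
  have h1 : μ (ball x (r / 2)) ≤ (K : ℝ≥0∞) ^ 3 * μ (ball y (r / 2)) :=
    hd.measure_ball_le (by positivity) 3 (by rw [hy]; linarith)
  calc _ = (K : ℝ≥0∞) ^ 3 * μ (ball x (r / 2)) + μ (ball x (r / 2)) := by ring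
    _ ≤ (K : ℝ≥0∞) ^ 3 * μ (ball x (r / 2)) + (K : ℝ≥0∞) ^ 3 * μ (ball y (r / 2)) := by gcongr
    _ = (K : ℝ≥0∞) ^ 3 * μ (ball x (r / 2) ∪ ball y (r / 2)) := by
        rw [measure_union hdisj measurableSet_ball, mul_add]
    _ ≤ _ := by
        gcongr
        refine Set.union_subset (ball_subset_ball (by linarith)) (ball_subset_ball' ?_)
        rw [dist_comm, hy]
        linarith

/-- Reverse doubling, at radii that are not large compared with the distance to some point. -/
theorem DoublingWith.exists_two_mul_measure_ball_le [BorelSpace X] [PreconnectedSpace X]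
    (hd : DoublingWith μ K) : ∃ n : ℕ, 0 < n ∧ ∀ (x z : X) (R : ℝ), 0 < R → R / 8 ≤ dist x z →
      2 * μ (ball x (R / 2 ^ n)) ≤ μ (ball x R) := by
  have hq : ∃ j : ℕ, (2 : ℝ) < (((K : ℝ) ^ 3 + 1) / (K : ℝ) ^ 3) ^ j := by
    refine pow_unbounded_of_one_lt _ ?_
    have : (0 : ℝ) < (K : ℝ) ^ 3 := pow_pos (by exact_mod_cast one_pos.trans_le hd.one_le) _
    rw [one_lt_div this]
    linarith
  obtain ⟨j, hj⟩ := hq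
  have hj' : 2 * ((K : ℝ≥0∞) ^ 3) ^ j ≤ ((K : ℝ≥0∞) ^ 3 + 1) ^ j := by
    have : (0 : ℝ) < (K : ℝ) ^ 3 := pow_pos (by exact_mod_cast one_pos.trans_le hd.one_le) _
    rw [div_pow, lt_div_iff₀ (by positivity)] at hj
    exact_mod_cast hj.le
  have hiter : ∀ (x z : X) (r : ℝ), 0 < r → r ≤ dist x z → ∀ i : ℕ,
      ((K : ℝ≥0∞) ^ 3 + 1) ^ i * μ (ball x (2 * r / 4 ^ i)) ≤
        ((K : ℝ≥0∞) ^ 3) ^ i * μ (ball x (2 * r)) := fun x z r hr hz i => by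
    induction i with
    | zero => simp
    | succ i ih =>
      have h1 := hd.add_measure_ball_le (x := x) (z := z) (r := r / 4 ^ i) (by positivity)
        ((div_le_self hr.le (one_le_pow₀ (by norm_num))).trans hz)
      have e1 : 2 * r / 4 ^ (i + 1) = r / 4 ^ i / 2 := by
        rw [pow_succ]; field_simp; norm_num
      have e2 : 2 * (r / 4 ^ i) = 2 * r / 4 ^ i := by ring
      rw [e2] at h1
      rw [e1]
      calc _ = ((K : ℝ≥0∞) ^ 3 + 1) ^ i *
            (((K : ℝ≥0∞) ^ 3 + 1) * μ (ball x (r / 4 ^ i / 2))) := by ring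
        _ ≤ ((K : ℝ≥0∞) ^ 3 + 1) ^ i * ((K : ℝ≥0∞) ^ 3 * μ (ball x (2 * r / 4 ^ i))) := by gcongr
        _ = (K : ℝ≥0∞) ^ 3 * (((K : ℝ≥0∞) ^ 3 + 1) ^ i * μ (ball x (2 * r / 4 ^ i))) := by ring
        _ ≤ (K : ℝ≥0∞) ^ 3 * (((K : ℝ≥0∞) ^ 3) ^ i * μ (ball x (2 * r))) := by gcongr
        _ = _ := by ring
  refine ⟨2 * j + 2, by lia, fun x z R hR hz => ?_⟩
  have h1 := hiter x z (R / 8) (by positivity) hz j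
  have e1 : R / 2 ^ (2 * j + 2) = 2 * (R / 8) / 4 ^ j := by
    rw [pow_add, pow_mul]; norm_num; field_simp; norm_num
  rw [e1]
  have hK : ((K : ℝ≥0∞) ^ 3) ^ j ≠ 0 :=
    pow_ne_zero _ (pow_ne_zero _ (by exact_mod_cast (one_pos.trans_le hd.one_le).ne'))
  refine (ENNReal.mul_le_mul_iff_right hK (by finiteness)).1 ?_
  calc _ = 2 * ((K : ℝ≥0∞) ^ 3) ^ j * μ (ball x (2 * (R / 8) / 4 ^ j)) := by ring
    _ ≤ ((K : ℝ≥0∞) ^ 3 + 1) ^ j * μ (ball x (2 * (R / 8) / 4 ^ j)) := by gcongr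
    _ ≤ ((K : ℝ≥0∞) ^ 3) ^ j * μ (ball x (2 * (R / 8))) := h1
    _ ≤ _ := by
      gcongr
      linarith

end ReverseDoubling

end MetricBV

namespace MetricBV

/-! ### Cut-off functions and their extensions -/

variable {X : Type*} [MetricSpace X]

/-- The cut-off function that is `1` on `closedBall x a`, vanishes off `ball x b` and is affine in
the distance to `x` in between. -/
noncomputable def cutoff (x : X) (a b : ℝ) (y : X) : ℝ :=
  max 0 (min 1 ((b - dist y x) / (b - a)))

theorem cutoff_eq_one {x y : X} {a b : ℝ} (hab : a < b) (hy : y ∈ closedBall x a) :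
    cutoff x a b y = 1 := by
  have h1 : 1 ≤ (b - dist y x) / (b - a) := by
    rw [one_le_div (by linarith)]
    linarith [mem_closedBall.1 hy]
  simp [cutoff, min_eq_left h1]

theorem cutoff_eq_zero {x y : X} {a b : ℝ} (hab : a < b) (hy : b ≤ dist y x) :
    cutoff x a b y = 0 := by
  have h1 : (b - dist y x) / (b - a) ≤ 0 := div_nonpos_of_nonpos_of_nonneg (by linarith)
    (by linarith)
  exact max_eq_left ((min_le_right _ _).trans h1)

theorem cutoff_nonneg (x y : X) (a b : ℝ) : 0 ≤ cutoff x a b y := le_max_left _ _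

theorem cutoff_le_one (x y : X) (a b : ℝ) : cutoff x a b y ≤ 1 :=
  max_le zero_le_one (min_le_left _ _)

theorem lipschitzWith_cutoff (x : X) {a b : ℝ} (hab : a < b) :
    LipschitzWith (Real.toNNReal (1 / (b - a))) (cutoff x a b) := by
  have hpos : 0 < b - a := by linarith
  have h : LipschitzWith (Real.toNNReal (1 / (b - a))) fun y : X => (b - dist y x) / (b - a) := by
    refine LipschitzWith.of_dist_le_mul fun y z => ?_
    rw [Real.coe_toNNReal _ (by positivity), Real.dist_eq, ← sub_div, abs_div, abs_of_pos hpos,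
      one_div, inv_mul_eq_div]
    gcongr
    rw [sub_sub_sub_cancel_left, abs_sub_comm]
    exact abs_dist_sub_le y z x
  exact (h.const_min 1).const_max 0

variable [MeasurableSpace X]

theorem totalVariation_le_lintegral_lip {ν : Measure X} {u : X → ℝ} (hu : LocallyLipschitz u)
    (B : Set X) : totalVariation ν u B ≤ ∫⁻ x, lip u x ∂ν := by
  refine iInf_le_of_le Set.univ (iInf_le_of_le isOpen_univ (iInf_le_of_le (Set.subset_univ B)
    (iInf_le_of_le (fun _ => u) (iInf_le_of_le (fun _ => locallyLipschitzOn_univ.2 hu)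
    (iInf_le_of_le (fun x _ => ⟨Set.univ, univ_mem, by simp⟩) ?_)))))
  simp

theorem totalVariation_congr {ν : Measure X} {u u' : X → ℝ} (h : u =ᵐ[ν] u') (B : Set X) :
    totalVariation ν u B = totalVariation ν u' B := by
  have key : ∀ A v, TendstoL1Loc ν A v u ↔ TendstoL1Loc ν A v u' := fun A v => by
    have : ∀ (U : Set X) (n : ℕ), ∫⁻ y in U ∩ A, ‖v n y - u y‖ₑ ∂ν =
        ∫⁻ y in U ∩ A, ‖v n y - u' y‖ₑ ∂ν := fun U n =>
      lintegral_congr_ae ((ae_restrict_of_ae h).mono fun y hy => by simp only [hy])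
    simp only [TendstoL1Loc, this]
  simp only [totalVariation, totalVariationOpen, key]

theorem bvNorm_congr {μ : Measure X} {B : Set X} {u u' : X → ℝ} (h : u =ᵐ[μ.restrict B] u') :
    bvNorm μ B u = bvNorm μ B u' := by
  rw [bvNorm, bvNorm, totalVariation_congr h]
  congr 1
  exact lintegral_congr_ae (h.mono fun y hy => by simp only [hy])

theorem totalVariation_le_bvNorm_univ (μ : Measure X) (u : X → ℝ) :
    totalVariation μ u Set.univ ≤ bvNorm μ Set.univ u := by
  rw [bvNorm, Measure.restrict_univ]
  exact le_add_self

variable [BorelSpace X] {μ : Measure X} {E : Set X}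

theorem bvNorm_cutoff_le (x : X) {a b : ℝ} (hab : a < b) :
    bvNorm μ E (cutoff x a b) ≤
      (1 + ENNReal.ofReal (1 / (b - a))) * μ (closedBall x b ∩ E) := by
  have hout : ∀ y, y ∉ closedBall x b → b < dist y x := fun y hy => by simpa using hy
  have hind : ∀ (f : X → ℝ≥0∞) (c : ℝ≥0∞), (∀ y, f y ≤ c) → (∀ y ∉ closedBall x b, f y = 0) →
      ∫⁻ y in E, f y ∂μ ≤ c * μ (closedBall x b ∩ E) := fun f c hc h0 => by
    calc ∫⁻ y in E, f y ∂μ ≤ ∫⁻ y in E, (closedBall x b).indicator (fun _ => c) y ∂μ := by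
          refine lintegral_mono fun y => ?_
          by_cases hy : y ∈ closedBall x b
          · rw [Set.indicator_of_mem hy]; exact hc y
          · rw [Set.indicator_of_notMem hy, h0 y hy]
      _ = _ := by
          rw [lintegral_indicator_const measurableSet_closedBall,
            Measure.restrict_apply measurableSet_closedBall]
  rw [bvNorm, add_mul]
  refine add_le_add ?_ ?_
  · refine hind _ 1 (fun y => ?_) fun y hy => ?_
    · rw [Real.enorm_eq_ofReal (cutoff_nonneg _ _ _ _), ← ENNReal.ofReal_one]
      exact ENNReal.ofReal_le_ofReal (cutoff_le_one _ _ _ _)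
    · simp [cutoff_eq_zero hab (hout y hy).le]
  · refine (totalVariation_le_lintegral_lip (lipschitzWith_cutoff x hab).locallyLipschitz E).trans
      (hind _ _ (fun y => lip_le_of_lipschitzWith (lipschitzWith_cutoff x hab) y) fun y hy => ?_)
    refine lip_eq_zero_of_eventually_eq ?_
    filter_upwards [isClosed_closedBall.isOpen_compl.mem_nhds hy] with z hz
    rw [cutoff_eq_zero hab (hout z hz).le, cutoff_eq_zero hab (hout y hy).le]

/-- A cut-off function on a `BV`-extension set `E` extends to a function on `X` whose total
variation is controlled by the measure of the part of `E` in the support of the cut-off. -/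
theorem IsBVExtensionSet.exists_extension_cutoff (hE : IsBVExtensionSet μ E)
    (hfin : μ E < ∞) : ∃ C : ℝ≥0, ∀ (x : X) (a b : ℝ), a < b →
      ∃ v : X → ℝ, AEMeasurable v μ ∧ (∀ᵐ y ∂μ, y ∈ E → v y = cutoff x a b y) ∧
        totalVariation μ v Set.univ ≤
          C * ((1 + ENNReal.ofReal (1 / (b - a))) * μ (closedBall x b ∩ E)) := by
  obtain ⟨hEm, C, T, -, hT⟩ := hE
  refine ⟨C, fun x a b hab => ?_⟩
  have : IsFiniteMeasure (μ.restrict E) := isFiniteMeasure_restrict.2 hfin.ne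
  have hmeas : AEStronglyMeasurable (cutoff x a b) (μ.restrict E) :=
    (lipschitzWith_cutoff x hab).continuous.measurable.aestronglyMeasurable
  have hint : Integrable (cutoff x a b) (μ.restrict E) :=
    Integrable.of_bound hmeas 1 (Eventually.of_forall fun y => by
      rw [Real.norm_of_nonneg (cutoff_nonneg _ _ _ _)]; exact cutoff_le_one _ _ _ _)
  have hco : (AEEqFun.mk (cutoff x a b) hmeas : X → ℝ) =ᵐ[μ.restrict E] cutoff x a b :=
    AEEqFun.coeFn_mk _ hmeas
  have hnorm := bvNorm_cutoff_le (μ := μ) (E := E) x hab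
  have hlt : bvNorm μ E (cutoff x a b) < ∞ := hnorm.trans_lt <|
    ENNReal.mul_lt_top (by finiteness) ((measure_mono Set.inter_subset_right).trans_lt hfin)
  have hmem : AEEqFun.mk (cutoff x a b) hmeas ∈ BV μ E := by
    refine ⟨hint.congr hco.symm, ?_⟩
    rw [totalVariation_congr hco]
    exact le_add_self.trans_lt hlt
  obtain ⟨h1, h2⟩ := hT ⟨_, hmem⟩
  set v := (T ⟨_, hmem⟩).1
  refine ⟨v, ?_, ?_, ?_⟩
  · exact v.aestronglyMeasurable.aemeasurable.mono_measure Measure.restrict_univ.ge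
  · filter_upwards [(ae_restrict_iff' hEm).1 h1, (ae_restrict_iff' hEm).1 hco] with y hy1 hy2 hy
    rw [hy1 hy, hy2 hy]
  · refine (totalVariation_le_bvNorm_univ μ v).trans (h2.trans ?_)
    rw [bvNorm_congr hco]
    gcongr

end MetricBV

namespace MetricBV

/-! ### De Giorgi iteration and propagation of the density bound -/

/-- De Giorgi iteration: with the choice `n = i + n₀` of the free parameter, `hM` excludes the first
alternative and `hz` the third, and the second gives geometric decay of `F`. -/
theorem le_geometric_of_alternatives {F : ℕ → ℝ} {B c M z : ℝ} {n₀ : ℕ} (hB : 1 ≤ B) (hc : 0 ≤ c)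
    (hF : ∀ i, 0 < F i) (hn₀ : 2 * B * c ≤ 2 ^ n₀) (hz : F 0 ≤ z) (hM : B ^ n₀ * c * F 0 < M)
    (h : ∀ i n : ℕ, M ≤ B ^ n * (c * (2 ^ i * F i)) ∨ 2 ^ n * F (i + 1) ≤ c * (2 ^ i * F i) ∨
      2 ^ n * z ≤ c * (2 ^ i * F i)) (i : ℕ) :
    (2 * B) ^ i * F i ≤ F 0 := by
  have hB0 : 0 < B := by linarith
  induction i with
  | zero => simp
  | succ i ih =>
    have h2 : (0 : ℝ) < 2 ^ i := by positivity
    have hle : F i ≤ F 0 :=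
      (le_mul_of_one_le_left (hF i).le (one_le_pow₀ (by linarith))).trans ih
    rcases h i (i + n₀) with h | h | h
    · have : M ≤ B ^ n₀ * c * F 0 := by
        calc M ≤ B ^ n₀ * c * ((2 * B) ^ i * F i) := h.trans_eq (by rw [mul_pow, pow_add]; ring)
          _ ≤ _ := by gcongr
      linarith
    · have h3 : 2 ^ n₀ * F (i + 1) ≤ c * F i := by
        refine le_of_mul_le_mul_left ?_ h2
        rw [pow_add] at h
        linarith
      have h4 : 2 * B * F (i + 1) ≤ F i := by
        have h5 : 2 ^ n₀ * (2 * B * F (i + 1)) ≤ 2 ^ n₀ * F i := by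
          calc 2 ^ n₀ * (2 * B * F (i + 1)) = 2 * B * (2 ^ n₀ * F (i + 1)) := by ring
            _ ≤ 2 * B * (c * F i) := by gcongr
            _ = 2 * B * c * F i := by ring
            _ ≤ _ := mul_le_mul_of_nonneg_right hn₀ (hF i).le
        exact le_of_mul_le_mul_left h5 (by positivity)
      calc (2 * B) ^ (i + 1) * F (i + 1) = (2 * B) ^ i * (2 * B * F (i + 1)) := by ring
        _ ≤ (2 * B) ^ i * F i := by gcongr
        _ ≤ F 0 := ih
    · have h3 : 2 ^ n₀ * z ≤ c * F 0 := by
        refine le_of_mul_le_mul_left ?_ h2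
        rw [pow_add] at h
        have : c * (2 ^ i * F i) ≤ c * (2 ^ i * F 0) := by gcongr
        linarith
      -- hence `2 * B * z ≤ F 0 ≤ z`, which is absurd
      have h4 : 2 * B * (c * F 0) ≤ 2 ^ n₀ * F 0 := by
        rw [← mul_assoc]; exact mul_le_mul_of_nonneg_right hn₀ (hF 0).le
      have h5 : 2 ^ n₀ * (2 * B * z) ≤ 2 ^ n₀ * F 0 := by
        refine le_trans (le_of_eq_of_le ?_ (mul_le_mul_of_nonneg_left h3
          (by positivity : 0 ≤ 2 * B))) h4
        ring
      have h6 := le_of_mul_le_mul_left h5 (by positivity)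
      have h7 := hF 0
      nlinarith

variable {X : Type*} [MetricSpace X] [MeasurableSpace X] [BorelSpace X] [ProperSpace X]
  {μ : Measure X} {K : ℝ≥0} {E : Set X}

/-- Energy dichotomy for the cut-off functions of a `BV`-extension set, at scale `R ≤ R₀`: the
extension of `cutoff x a b` is `1` on the part of `E` in `closedBall x a` and `0` on any `Z ⊆ E` off
`ball x b`, and the two-set isoperimetric inequality applies to it. -/
theorem IsBVExtensionSet.exists_alternatives (hd : DoublingWith μ K) {C Λ : ℝ}
    (hP : PoincareWith μ C Λ) (hE : IsBVExtensionSet μ E) (hfin : μ E < ∞) {R₀ : ℝ}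
    (hR₀ : 0 < R₀) : ∃ c : ℝ, 0 ≤ c ∧ ∀ (x : X) (R a b : ℝ), 0 < R → a < b → b < R → b - a ≤ R₀ →
      0 < μ (closedBall x b ∩ E) → ∀ Z ⊆ ball x R ∩ E, (∀ y ∈ Z, b ≤ dist y x) → ∀ n : ℕ,
      μ.real (ball x R) ≤
          ((K : ℝ) ^ 2) ^ n * (c * (R / (b - a) * μ.real (closedBall x b ∩ E))) ∨
      2 ^ n * μ.real (closedBall x a ∩ E) ≤ c * (R / (b - a) * μ.real (closedBall x b ∩ E)) ∨
      2 ^ n * μ.real Z ≤ c * (R / (b - a) * μ.real (closedBall x b ∩ E)) := by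
  obtain ⟨C₁, hC₁⟩ := exists_twoSet_isoperimetric hd hP
  obtain ⟨C₂, hC₂⟩ := hE.exists_extension_cutoff hfin
  refine ⟨C₁ * (2 * (C₂ + 1) * (R₀ + 1)), by positivity,
    fun x R a b hR hab hbR hgap hpos Z hZ hZb n => ?_⟩
  have hg : 0 < b - a := by linarith
  set F := μ.real (closedBall x b ∩ E) with hF
  have hFfin : μ (closedBall x b ∩ E) < ∞ := (measure_mono Set.inter_subset_right).trans_lt hfin
  have hFpos : 0 < F := ENNReal.toReal_pos hpos.ne' hFfin.ne
  obtain ⟨v, hvm, hvE, hTV⟩ := hC₂ x a b hab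
  set D : ℝ := 2 * (C₂ + 1) * (R₀ + 1) / (b - a) * F with hD
  have hTV' : totalVariation μ v Set.univ < ENNReal.ofReal D := by
    refine hTV.trans_lt ?_
    have e : (C₂ : ℝ≥0∞) * ((1 + ENNReal.ofReal (1 / (b - a))) * μ (closedBall x b ∩ E)) =
        ENNReal.ofReal (C₂ * ((1 + 1 / (b - a)) * F)) := by
      rw [ENNReal.ofReal_mul (by positivity), ENNReal.ofReal_mul (by positivity),
        ENNReal.ofReal_add zero_le_one (by positivity), ENNReal.ofReal_one, hF,
        ofReal_measureReal hFfin.ne, ENNReal.ofReal_coe_nnreal]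
    rw [e, ENNReal.ofReal_lt_ofReal_iff (by positivity)]
    -- `b - a ≤ R₀` lets the gradient term absorb the `L¹` term of the norm
    have h1 : 1 + 1 / (b - a) ≤ (R₀ + 1) / (b - a) := by
      rw [add_div]
      gcongr
      rwa [one_le_div hg]
    calc C₂ * ((1 + 1 / (b - a)) * F) ≤ C₂ * ((R₀ + 1) / (b - a) * F) := by gcongr
      _ < 2 * (C₂ + 1) * ((R₀ + 1) / (b - a) * F) := by
          refine mul_lt_mul_of_pos_right ?_ (by positivity)
          linarith [C₂.coe_nonneg]
      _ = D := by rw [hD]; ring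
  have hA : closedBall x a ∩ E ⊆ ball x R :=
    Set.inter_subset_left.trans (closedBall_subset_ball (by linarith))
  have key := hC₁ v hvm x R hR n (closedBall x a ∩ E) Z hA (hZ.trans Set.inter_subset_left)
    (hvE.mono fun y hy hyA => by rw [hy hyA.2, cutoff_eq_one hab hyA.1])
    (hvE.mono fun y hy hyZ => by rw [hy (hZ hyZ).2, cutoff_eq_zero hab (hZb y hyZ)]) _ hTV'
  have hDnn : 0 ≤ D := by positivity
  have e : (C₁ : ℝ) * (2 * (C₂ + 1) * (R₀ + 1)) * (R / (b - a) * F) = C₁ * R * D := by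
    rw [hD]; ring
  rw [e]
  refine key.imp (fun h => ?_) (Or.imp (fun h => ?_) fun h => ?_) <;>
  · have := ENNReal.toReal_mono (by finiteness) h
    simp only [ENNReal.toReal_mul, ENNReal.toReal_pow, ENNReal.coe_toReal,
      ENNReal.toReal_ofReal hR.le, ENNReal.toReal_ofReal hDnn, ENNReal.toReal_ofNat] at this
    simp only [Measure.real]
    linarith

/-- Propagation of the density lower bound to a smaller scale. If the density of `E` in
`B (x, R / 2ⁿ)` were below `η`, reverse doubling would leave at least half of `E ∩ B (x, R)` outside
`B (x, R / 2ⁿ)`, and the De Giorgi iteration over the radii `(1 + 2⁻ⁱ) R / 2ⁿ⁺²` would show that `E`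
has measure zero near `x`. -/
theorem IsBVExtensionSet.exists_density_step (hd : DoublingWith μ K) {C Λ : ℝ}
    (hP : PoincareWith μ C Λ) (hE : IsBVExtensionSet μ E) (hfin : μ E < ∞) {R₀ : ℝ}
    (hR₀ : 0 < R₀) : ∃ n : ℕ, 0 < n ∧ ∃ η₀ : ℝ, 0 < η₀ ∧ ∀ η : ℝ, 0 < η → η ≤ η₀ →
      ∀ (x z : X) (R : ℝ), 0 < R → R ≤ R₀ → R / 8 ≤ dist x z →
      (∀ ρ : ℝ, 0 < ρ → 0 < μ (ball x ρ ∩ E)) →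
      η * μ.real (ball x R) ≤ μ.real (ball x R ∩ E) →
      η * μ.real (ball x (R / 2 ^ n)) ≤ μ.real (ball x (R / 2 ^ n) ∩ E) := by
  have := hP.preconnectedSpace hd
  obtain ⟨n, hn, hrev⟩ := hd.exists_two_mul_measure_ball_le
  obtain ⟨c₀, hc₀, halt⟩ := hE.exists_alternatives hd hP hfin hR₀
  set B : ℝ := (K : ℝ) ^ 2 with hBdef
  have hB : 1 ≤ B := one_le_pow₀ (by exact_mod_cast hd.one_le)
  -- `R / (ρ i - ρ (i + 1)) = 2 ^ (n + 3) * 2 ^ i` for the radii used below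
  set c : ℝ := c₀ * 2 ^ (n + 3) with hcdef
  have hc : 0 ≤ c := by positivity
  obtain ⟨n₀, hn₀⟩ : ∃ n₀ : ℕ, 2 * B * c < 2 ^ n₀ := pow_unbounded_of_one_lt _ (by norm_num)
  -- this `η₀` makes `B ^ n₀ * c * F 0 < M`, because `F 0 ≤ η * M / 2`
  refine ⟨n, hn, 1 / (B ^ n₀ * (c + 1)), by positivity, fun η hη hηle x z R hR hRR₀ hz hpos hdens =>
    ?_⟩
  by_contra! hcon
  have hEfin : ∀ s : Set X, μ (s ∩ E) ≠ ∞ := fun s =>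
    ((measure_mono Set.inter_subset_right).trans_lt hfin).ne
  set M := μ.real (ball x R) with hM
  have hMpos : 0 < M := ENNReal.toReal_pos (hd.pos x R hR).ne' (hd.lt_top x R).ne
  have hrev' : 2 * μ.real (ball x (R / 2 ^ n)) ≤ M := by
    have := ENNReal.toReal_mono (hd.lt_top x R).ne (hrev x z R hR hz)
    simpa [Measure.real, hM] using this
  have hsmall : μ.real (ball x (R / 2 ^ n) ∩ E) ≤ η * M / 2 := by nlinarith
  set ρ : ℕ → ℝ := fun i => R / 2 ^ (n + 2) * (1 + (1 / 2) ^ i) with hρ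
  set F : ℕ → ℝ := fun i => μ.real (closedBall x (ρ i) ∩ E) with hF
  have hr1 : R / 2 ^ (n + 2) = R / 2 ^ n / 4 := by rw [pow_add, ← div_div]; norm_num
  have hr0 : 0 < R / 2 ^ n := by positivity
  have hr2 : R / 2 ^ n ≤ R := div_le_self hR.le (one_le_pow₀ (by norm_num))
  have hρlt : ∀ i, ρ i < R / 2 ^ n := fun i => by
    have : (1 / 2 : ℝ) ^ i ≤ 1 := pow_le_one₀ (by norm_num) (by norm_num)
    simp only [hρ, hr1]
    nlinarith
  have hρgt : ∀ i, R / 2 ^ (n + 2) < ρ i := fun i =>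
    lt_mul_of_one_lt_right (by positivity) (by linarith [pow_pos (one_half_pos (α := ℝ)) i])
  have hρgap : ∀ i, ρ i - ρ (i + 1) = R / (2 ^ (n + 3) * 2 ^ i) := fun i => by
    simp only [hρ, pow_succ, one_div, inv_pow]
    field_simp
    ring
  set s := μ.real (ball x (R / 2 ^ (n + 2)) ∩ E) with hs
  have hspos : 0 < s := ENNReal.toReal_pos (hpos _ (by positivity)).ne' (hEfin _)
  have hsF : ∀ i, s ≤ F i := fun i => measureReal_mono
    (Set.inter_subset_inter_left _ ((ball_subset_ball (hρgt i).le).trans ball_subset_closedBall))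
    (hEfin _)
  have hFsmall : F 0 ≤ η * M / 2 := (measureReal_mono (Set.inter_subset_inter_left _
    (closedBall_subset_ball (hρlt 0))) (hEfin _)).trans hsmall
  set Z := (ball x R ∩ E) \ ball x (R / 2 ^ n) with hZ
  have hZbig : η * M / 2 ≤ μ.real Z := by
    have h1 : μ.real (ball x R ∩ E) ≤ μ.real (ball x (R / 2 ^ n) ∩ E) + μ.real Z := by
      refine (measureReal_mono (fun y hy => ?_) ?_).trans (measureReal_union_le _ _)
      · by_cases hy' : y ∈ ball x (R / 2 ^ n)
        · exact Or.inl ⟨hy', hy.2⟩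
        · exact Or.inr ⟨hy, hy'⟩
      · refine ((measure_mono (Set.union_subset Set.inter_subset_right ?_)).trans_lt hfin).ne
        exact Set.sdiff_subset.trans Set.inter_subset_right
    linarith
  have hdecay := le_geometric_of_alternatives (F := F) (B := B) (c := c) (M := M) (z := μ.real Z)
    (n₀ := n₀) hB hc (fun i => hspos.trans_le (hsF i)) hn₀.le (hFsmall.trans hZbig) (by
      have h1 : η * (B ^ n₀ * (c + 1)) ≤ 1 := by rwa [le_div_iff₀ (by positivity)] at hηle
      have h2 : B ^ n₀ * c * F 0 ≤ B ^ n₀ * (c + 1) * (η * M / 2) := by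
        gcongr
        linarith
      have h3 : η * (B ^ n₀ * (c + 1)) * M ≤ 1 * M := by gcongr
      linarith) (fun i m => by
      have h := halt x R (ρ (i + 1)) (ρ i) hR
        (by have : 0 < ρ i - ρ (i + 1) := by rw [hρgap]; positivity
            linarith) ((hρlt i).trans_le hr2)
        (by linarith [hρlt i, hρgt (i + 1), show 0 < R / 2 ^ (n + 2) by positivity])
        ((hpos (ρ i) ((show 0 < R / 2 ^ (n + 2) by positivity).trans (hρgt i))).trans_le
          (measure_mono (Set.inter_subset_inter_left _ ball_subset_closedBall)))
        Z Set.sdiff_subset (fun y hy => by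
          have := hy.2
          rw [mem_ball, not_lt] at this
          linarith [hρlt i]) m
      have e : c₀ * (R / (ρ i - ρ (i + 1)) * μ.real (closedBall x (ρ i) ∩ E)) =
          c * (2 ^ i * F i) := by
        rw [hρgap, hcdef, div_div_cancel₀ hR.ne']
        ring
      rwa [e] at h)
  -- `F` is bounded below by `s > 0`, so it cannot decay
  obtain ⟨i, hi⟩ : ∃ i : ℕ, F 0 / s < (2 * B) ^ i := pow_unbounded_of_one_lt _ (by linarith)
  rw [div_lt_iff₀ hspos] at hi
  have h1 : (2 * B) ^ i * s ≤ (2 * B) ^ i * F i := by gcongr; exact hsF i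
  linarith [hdecay i]

omit [BorelSpace X] [ProperSpace X] in
theorem measure_ball_inter_pos_of_mem_closure {x : X}
    (hx : x ∈ closure (Set.univ \ densityZero μ E)) {ρ : ℝ} (hρ : 0 < ρ) :
    0 < μ (ball x ρ ∩ E) := by
  obtain ⟨y, hy, hxy⟩ := Metric.mem_closure_iff.1 hx (ρ / 2) (half_pos hρ)
  refine pos_iff_ne_zero.2 fun h0 => hy.2 ?_
  have hev : (fun r : ℝ => μ (ball y r ∩ E) / μ (ball y r)) =ᶠ[𝓝[>] 0] fun _ => 0 := by
    filter_upwards [Ioo_mem_nhdsGT (half_pos hρ)] with r hr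
    rw [measure_mono_null (Set.inter_subset_inter_left E (ball_subset_ball' ?_)) h0,
      ENNReal.zero_div]
    rw [dist_comm]
    linarith [hr.2]
  rw [densityZero, Set.mem_ofPred_eq, limsup_congr hev]
  exact le_antisymm (limsup_le_of_le (by isBoundedDefault) (by simp)) zero_le

end MetricBV

theorem mainTheorem4 {X : Type*} [MetricSpace X] [CompleteSpace X]
    [TopologicalSpace.SeparableSpace X] [MeasurableSpace X] [BorelSpace X]
    (μ : Measure X) (hμ : MetricBV.IsPISpace μ)
    (E : Set X) (hE : MetricBV.IsBVExtensionSet μ E)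
    (hbdd : Bornology.IsBounded E) (hpos : 0 < μ E) :
    ∃ C : ℝ, 0 < C ∧
      ∀ x ∈ closure (Set.univ \ MetricBV.densityZero μ E), ∀ r : ℝ, 0 < r → r < diam E →
        ENNReal.ofReal C * μ (ball x r) ≤ μ (ball x r ∩ E) := by
  rcases le_or_gt (diam E) 0 with hdiam | hdiam
  · exact ⟨1, one_pos, fun x _ r hr hrE => absurd hrE (by linarith)⟩
  obtain ⟨K, hd⟩ := hμ.doubling.exists_doublingWith
  obtain ⟨C, Λ, hP⟩ := hμ.poincare.exists_poincareWith
  have := hd.properSpace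
  obtain ⟨e, he⟩ : E.Nonempty := nonempty_of_measure_ne_zero hpos.ne'
  have hdist : ∀ x ∈ closure E, ∀ y ∈ E, dist y x ≤ diam E := fun x hx y hy => by
    rw [← diam_closure]
    exact dist_le_diam_of_mem hbdd.closure (subset_closure hy) hx
  have hfin : μ E < ∞ := (measure_mono fun y hy => mem_ball.2 ((hdist e (subset_closure he) y
    hy).trans_lt (lt_add_one _))).trans_lt (hd.lt_top e (diam E + 1))
  set R₀ := 2 * diam E with hR₀
  have hR₀pos : 0 < R₀ := by linarith
  obtain ⟨n, hn, η₀, hη₀, hstep⟩ := hE.exists_density_step hd hP hfin hR₀pos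
  have hQ : 0 < μ.real (ball e (2 * R₀)) :=
    ENNReal.toReal_pos (hd.pos _ _ (by linarith)).ne' (hd.lt_top _ _).ne
  have hEr : 0 < μ.real E := ENNReal.toReal_pos hpos.ne' hfin.ne
  -- the second term is a lower bound for the density of `E` at the scale `R₀`
  set η := min η₀ (μ.real E / μ.real (ball e (2 * R₀))) with hη
  have hηpos : 0 < η := lt_min hη₀ (by positivity)
  have hKpos : (0 : ℝ) < K := by exact_mod_cast one_pos.trans_le hd.one_le
  refine ⟨η / K ^ n, by positivity, fun x hx r hr hrE => ?_⟩
  have hxpos : ∀ ρ : ℝ, 0 < ρ → 0 < μ (ball x ρ ∩ E) := fun ρ hρ =>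
    MetricBV.measure_ball_inter_pos_of_mem_closure hx hρ
  have hxE : x ∈ closure E := Metric.mem_closure_iff.2 fun ε hε => by
    obtain ⟨y, hy⟩ := nonempty_of_measure_ne_zero (hxpos ε hε).ne'
    exact ⟨y, hy.2, mem_ball'.1 hy.1⟩
  obtain ⟨z, hz⟩ : ∃ z, R₀ / 8 ≤ dist x z := by
    by_contra! hcon
    have := diam_le_of_subset_closedBall (s := E) (x := x) (r := R₀ / 8) (by positivity)
      fun y _ => mem_closedBall'.2 (hcon y).le
    linarith
  have hdens : ∀ k : ℕ, η * μ.real (ball x (R₀ / (2 ^ n) ^ k)) ≤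
      μ.real (ball x (R₀ / (2 ^ n) ^ k) ∩ E) := fun k => by
    induction k with
    | zero =>
      have hall : ball x (R₀ / (2 ^ n) ^ 0) ∩ E = E := Set.inter_eq_right.2 fun y hy => by
        rw [pow_zero, div_one, mem_ball]
        linarith [hdist x hxE y hy]
      have hsub : μ.real (ball x (R₀ / (2 ^ n) ^ 0)) ≤ μ.real (ball e (2 * R₀)) := by
        refine measureReal_mono (ball_subset_ball' ?_) (hd.lt_top _ _).ne
        rw [pow_zero, div_one, dist_comm]
        linarith [hdist x hxE e he]
      rw [hall]
      calc _ ≤ μ.real E / μ.real (ball e (2 * R₀)) * μ.real (ball e (2 * R₀)) := by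
            gcongr
            exact min_le_right _ _
        _ = μ.real E := div_mul_cancel₀ _ hQ.ne'
    | succ k ih =>
      have hle : R₀ / (2 ^ n) ^ k ≤ R₀ :=
        div_le_self hR₀pos.le (one_le_pow₀ (one_le_pow₀ one_le_two))
      have := hstep η hηpos (min_le_left _ _) x z (R₀ / (2 ^ n) ^ k) (by positivity) hle
        (by linarith) hxpos ih
      rwa [div_div, ← pow_succ] at this
  obtain ⟨k, hk1, hk2⟩ := exists_nat_pow_near (x := R₀ / r) (y := (2 : ℝ) ^ n)
    ((one_le_div hr).2 (by linarith)) (one_lt_pow₀ one_lt_two hn.ne')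
  set t := R₀ / (2 ^ n) ^ (k + 1) with ht
  have htpos : 0 < t := by positivity
  have htr : t ≤ r := by
    rw [ht, div_le_iff₀ (by positivity)]
    rw [div_lt_iff₀ hr] at hk2
    linarith
  have hrt : r ≤ 2 ^ n * t := by
    have : 2 ^ n * t = R₀ / (2 ^ n) ^ k := by
      rw [ht, pow_succ]
      field_simp
    rw [this, le_div_iff₀ (by positivity)]
    rw [le_div_iff₀ hr] at hk1
    linarith
  have hball : μ.real (ball x r) ≤ (K : ℝ) ^ n * μ.real (ball x t) := by
    have h1 := (measure_mono (ball_subset_ball (x := x) hrt)).trans (hd.double_pow x htpos n)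
    have h2 := ENNReal.toReal_mono (ENNReal.mul_ne_top (by finiteness) (hd.lt_top x t).ne) h1
    simpa [Measure.real] using h2
  have hfinal : η / K ^ n * μ.real (ball x r) ≤ μ.real (ball x r ∩ E) := by
    calc η / K ^ n * μ.real (ball x r) ≤ η / K ^ n * (K ^ n * μ.real (ball x t)) := by gcongr
      _ = η * μ.real (ball x t) := by field_simp
      _ ≤ μ.real (ball x t ∩ E) := hdens (k + 1)
      _ ≤ _ := measureReal_mono (Set.inter_subset_inter_left _ (ball_subset_ball htr))
        ((measure_mono Set.inter_subset_right).trans_lt hfin).ne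
  rw [← ofReal_measureReal (μ := μ) (s := ball x r) (hd.lt_top x r).ne,
    ← ofReal_measureReal (μ := μ) (s := ball x r ∩ E)
      ((measure_mono Set.inter_subset_right).trans_lt hfin).ne,
    ← ENNReal.ofReal_mul (by positivity)]
  exact ENNReal.ofReal_le_ofReal hfinal
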